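/- For an infinite cardinal $\mu$ and a cardinal $\theta$, write $\theta^{<\mu}=\sup_{\nu<\mu}\theta^{\nu}$; a cardinal $\lambda\ge\mu$ is \emph{almost $\mu$-closed} if $\theta^{<\mu}\le\lambda$ for all $\theta<\lambda$; and $\mathrm{SCH}_{\mu,\ge\theta}$ is the statement that every cardinal $\lambda\ge\theta+\mu$ is almost $\mu$-closed. For an object $M$ of an accessible category $\mathcal K$, the presentability rank $r_{\mathcal K}(M)$ is the least regular cardinal $\kappa$ such that $M$ is $\kappa$-presentable, and the internal size $|M|_{\mathcal K}$ is $\kappa$ if $r_{\mathcal K}(M)=\kappa^+$ is a successor cardinal, and $r_{\mathcal K}(M)$ if it is a limit cardinal. A category is \emph{large} if it is not equivalent to a small category. Let $\mu$ be a regular cardinal and let $\mathcal K$ be a large $\mu$-accessible category all of whose morphisms are monomorphisms. Assume the generalized continuum hypothesis, or just $\mathrm{SCH}_{\mu,\ge\theta}$ for some cardinal $\theta$. Then there is a cardinal $\chi$ such that for every cardinal $\lambda\ge\chi$ with $\operatorname{cf}(\lambda)\ge\mu$ there is an object $M$ of $\mathcal K$ with $|M|_{\mathcal K}=\lambda$.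 -/

import Mathlib

universe w v u

open CategoryTheory Cardinal

/-- The generalized continuum hypothesis. -/
def GCH : Prop :=
  ∀ c : Cardinal.{w}, ℵ₀ ≤ c → (2 : Cardinal.{w}) ^ c = Order.succ c

/-- For infinite cardinals `μ ≤ lam`, the cardinal `lam` is almost `μ`-closed if
`θ ^{<μ} ≤ lam` for all `θ < lam`. -/
def IsAlmostClosed (μ lam : Cardinal.{w}) : Prop :=
  ∀ θ : Cardinal.{w}, θ < lam → θ ^< μ ≤ lam

/-- The hypothesis `SCH_{μ, ≥ θ}`: every cardinal `lam ≥ θ` (with `lam ≥ μ`, as is required for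
almost `μ`-closedness to make sense) is almost `μ`-closed. -/
def SCHAbove (μ θ : Cardinal.{w}) : Prop :=
  ∀ lam : Cardinal.{w}, μ ≤ lam → θ ≤ lam → IsAlmostClosed μ lam

section

variable {C : Type u} [Category.{v} C]

/-- The presentability rank of `M`: the least regular cardinal `κ` such that `M` is
`κ`-presentable. In an accessible category such a cardinal always exists, see
`isLeast_presentabilityRank`. -/
noncomputable def presentabilityRank (M : C) : Cardinal.{w} :=
  sInf {κ : Cardinal.{w} | ∃ _ : Fact κ.IsRegular, IsCardinalPresentable M κ}

theorem isLeast_presentabilityRank [IsAccessibleCategory.{w} C] (M : C) :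
    IsLeast {κ : Cardinal.{w} | ∃ _ : Fact κ.IsRegular, IsCardinalPresentable M κ}
      (presentabilityRank.{w} M) := by
  obtain ⟨κ, hκ, h⟩ := (inferInstance : IsPresentable.{w} M).exists_cardinal
  have hne : {κ : Cardinal.{w} |
      ∃ _ : Fact κ.IsRegular, IsCardinalPresentable M κ}.Nonempty := ⟨κ, hκ, h⟩
  exact ⟨csInf_mem hne, fun _ hx => csInf_le' hx⟩

open Classical in
/-- The internal size of `M`: it is `κ` if the presentability rank of `M` is a successor `κ⁺`,
and the presentability rank itself otherwise. -/
noncomputable def internalSize (M : C) : Cardinal.{w} :=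
  if h : ∃ κ : Cardinal.{w}, presentabilityRank.{w} M = Order.succ κ then h.choose
  else presentabilityRank.{w} M

theorem internalSize_eq_of_rank_eq_succ (M : C) (κ : Cardinal.{w})
    (h : presentabilityRank.{w} M = Order.succ κ) : internalSize.{w} M = κ := by
  have h' : ∃ κ : Cardinal.{w}, presentabilityRank.{w} M = Order.succ κ := ⟨κ, h⟩
  rw [internalSize, dif_pos h']
  exact Order.succ_injective (h'.choose_spec.symm.trans h)

theorem internalSize_eq_rank (M : C)
    (h : ∀ κ : Cardinal.{w}, presentabilityRank.{w} M ≠ Order.succ κ) :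
    internalSize.{w} M = presentabilityRank.{w} M := by
  rw [internalSize, dif_neg (by simpa using h)]

end

/-! For large `lam` with `μ ≤ cf lam`, the set-theoretic hypothesis gives `lam ^ ν ≤ lam` for `ν <
μ`, so a subset of size at most `lam` of a `μ`-directed poset lies in a `μ`-directed one of that
size. Largeness yields an object `N` that is not `lam⁺`-presentable; write it as a `μ`-directed
colimit of generators. As morphisms are monic, no `lam` terms of the diagram can absorb all the
others over `N`. Hence there is a chain of `lam` many `μ`-directed index sets, each with a term `x
i` that does not factor over `N` through earlier stages (`exists_chain_of_forall_exists_not_rel`).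
The colimit `M` over the union is `lam⁺`-presentable. Were its rank smaller, all maps from
generators to `M` would factor through one stage (`lam` regular), or through too few terms to carry
`lam` distinct maps (`lam` singular). So the rank is `lam⁺`
(`exists_isCardinalPresentable_succ_of_not`). -/

/-! ### Cardinal arithmetic. -/

theorem mk_Iio_lt_of_toType_ord {c : Cardinal.{w}} (i : c.ord.ToType) : #(Set.Iio i) < c := by
  simpa using mk_Iio_lt i

theorem exists_forall_lt_of_mk_lt_cof {c : Cardinal.{w}} {A : Type w} (hA : #A < c.ord.cof)
    (f : A → c.ord.ToType) : ∃ i, ∀ a, f a < i := by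
  by_contra! hf
  have hle : c.ord.cof ≤ #(Set.range f) := by
    rw [← Ordinal.cof_toType]
    refine Order.cof_le fun i ↦ ?_
    obtain ⟨a, ha⟩ := hf i
    exact ⟨_, Set.mem_range_self a, ha⟩
  exact (hle.trans mk_range_le).not_gt hA

/-- If `lam` is almost `μ`-closed and `μ ≤ cf lam`, then `lam ^ ν ≤ lam` for all `ν < μ`. -/
theorem IsAlmostClosed.power_le {μ lam : Cardinal.{w}} (h : IsAlmostClosed μ lam)
    (hlam : ℵ₀ ≤ lam) (hcof : μ ≤ lam.ord.cof) {ν : Cardinal.{w}} (hν : ν < μ) :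
    lam ^ ν ≤ lam := by
  -- As `ν < μ ≤ cf lam`, every function `ν → lam` is bounded, so `lam ^ ν` is at most the sum of
  -- the `|a| ^ ν` over `a < lam`.
  choose b hb using fun f : ν.out → lam.ord.ToType ↦
    exists_forall_lt_of_mk_lt_cof ((mk_out ν).trans_lt (hν.trans_le hcof)) f
  let g (f : ν.out → lam.ord.ToType) : Σ a : lam.ord.ToType, (ν.out → Set.Iio a) :=
    ⟨b f, fun k ↦ ⟨f k, hb f k⟩⟩
  have hg : Function.Injective g := by
    have : Function.LeftInverse (fun e : Σ a : lam.ord.ToType, (ν.out → Set.Iio a) ↦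
        fun k ↦ (e.2 k).1) g := fun f ↦ rfl
    exact this.injective
  have hmk := mk_le_of_injective hg
  rw [mk_sigma] at hmk
  calc lam ^ ν = #(ν.out → lam.ord.ToType) := by simp
    _ ≤ _ := hmk
    _ ≤ Cardinal.sum (fun _ : lam.ord.ToType ↦ lam) := by
        refine sum_le_sum _ _ fun a ↦ ?_
        rw [← power_def, mk_out]
        refine (le_powerlt _ hν).trans (h _ ?_)
        exact mk_Iio_lt_of_toType_ord a
    _ = lam := by simp [mul_eq_self hlam]

/-- With `m = max θ ν < lam` infinite, `θ ^ ν ≤ m ^ m = 2 ^ m = m⁺ ≤ lam`. -/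
theorem GCH.schAbove (h : GCH.{w}) {μ : Cardinal.{w}} (hμ : ℵ₀ ≤ μ) : SCHAbove μ μ := by
  intro lam hlam _ θ hθ
  refine powerlt_le.2 fun ν hν ↦ ?_
  have hm : max θ ν < lam := max_lt hθ (hν.trans_le hlam)
  rcases lt_or_ge (max θ ν) ℵ₀ with hfin | hinf
  · exact (power_lt_aleph0 ((le_max_left _ _).trans_lt hfin)
      ((le_max_right _ _).trans_lt hfin)).le.trans (hμ.trans hlam)
  · calc θ ^ ν ≤ max θ ν ^ ν := power_le_power_right (le_max_left _ _)
      _ ≤ max θ ν ^ max θ ν := power_le_power_left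
          (fun h0 ↦ (aleph0_pos.trans_le hinf).ne' h0) (le_max_right _ _)
      _ = Order.succ (max θ ν) := by rw [power_self_eq hinf, h _ hinf]
      _ ≤ lam := Order.succ_le_of_lt hm

/-! ### Directed subsets of a directed poset. -/

section

variable {J : Type w} [PartialOrder J] {μ : Cardinal.{w}} [Fact μ.IsRegular]

theorem isCardinalFiltered_coe_set {S : Set J}
    (h : ∀ ⦃A : Type w⦄ (f : A → J), #A < μ → (∀ a, f a ∈ S) → ∃ j ∈ S, ∀ a, f a ≤ j) :
    IsCardinalFiltered S μ :=
  isCardinalFiltered_preorder _ _ fun A f hA ↦ by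
    obtain ⟨j, hj, hle⟩ := h (fun a ↦ (f a).1) hA fun a ↦ (f a).2
    exact ⟨⟨j, hj⟩, hle⟩

theorem exists_mem_upperBound_of_isCardinalFiltered {S : Set J} [IsCardinalFiltered S μ]
    {A : Type w} (f : A → J) (hA : #A < μ) (hf : ∀ a, f a ∈ S) : ∃ j ∈ S, ∀ a, f a ≤ j := by
  have hA' : HasCardinalLT A μ := by rwa [hasCardinalLT_iff_cardinal_mk_lt]
  let g (a : A) : S := ⟨f a, hf a⟩
  exact ⟨_, (IsCardinalFiltered.max g hA').2, fun a ↦ leOfHom (IsCardinalFiltered.toMax g hA' a)⟩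

/-- Sorting the sets by a bound `|a|` with `a < μ` gives `μ` families, each of size at most `κ ^ |a|
≤ κ`. -/
theorem mk_setCardinalLT_le {κ : Cardinal.{w}} (hμκ : μ ≤ κ) (hκ : ∀ ν < μ, κ ^ ν ≤ κ)
    (X : Type w) (hX : #X ≤ κ) : #{t : Set X // #t < μ} ≤ κ := by
  have hμ : ℵ₀ ≤ μ := IsRegular.aleph0_le Fact.out
  let g (e : Σ a : μ.ord.ToType, {t : Set X // #t ≤ #(Set.Iio a)}) : {t : Set X // #t < μ} :=
    ⟨e.2.1, e.2.2.trans_lt (mk_Iio_lt_of_toType_ord e.1)⟩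
  have hg : Function.Surjective g := by
    rintro ⟨t, ht⟩
    obtain ⟨a, ha⟩ := Ordinal.typein_surj (α := μ.ord.ToType) (· < ·) (o := (#t).ord)
      (by simpa using ht)
    refine ⟨⟨a, t, ?_⟩, rfl⟩
    have := Ordinal.card_typein (r := ((· < ·) : μ.ord.ToType → μ.ord.ToType → Prop)) a
    rw [ha, card_ord] at this
    exact this.le
  refine (mk_le_of_surjective hg).trans ?_
  rw [mk_sigma]
  calc _ ≤ Cardinal.sum (fun _ : μ.ord.ToType ↦ κ) := by
        refine sum_le_sum _ _ fun a ↦ (mk_bounded_set_le _ _).trans ?_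
        exact (power_le_power_right (max_le hX (hμ.trans hμκ))).trans
          (hκ _ (mk_Iio_lt_of_toType_ord a))
    _ ≤ κ := by simpa using mul_le_of_le (hμ.trans hμκ) hμκ le_rfl

/-- In a `μ`-directed poset, a subset of cardinality at most `κ = κ ^{<μ}` is contained in a
`μ`-directed subset of cardinality at most `κ`. -/
theorem exists_isCardinalFiltered_superset [IsCardinalFiltered J μ] {κ : Cardinal.{w}}
    (hμκ : μ ≤ κ) (hκ : ∀ ν < μ, κ ^ ν ≤ κ) (A : Set J) (hA : #A ≤ κ) :
    ∃ B : Set J, A ⊆ B ∧ IsCardinalFiltered B μ ∧ #B ≤ κ := by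
  have hreg : Fact (Order.succ κ).IsRegular :=
    ⟨isRegular_succ ((IsRegular.aleph0_le Fact.out : ℵ₀ ≤ μ).trans hμκ)⟩
  -- This is the sharp inequality between `μ` and `κ⁺`: the subsets of size `< μ` of a set of size
  -- at most `κ` are few enough to form the required cofinal family themselves.
  obtain ⟨B, hAB, hB, hB'⟩ := SharplyLT.exists_isCardinalFiltered_set_of_exists_cofinal
    (κ₁ := μ) (κ₂ := Order.succ κ) (Order.lt_succ_of_le hμκ) (fun X hX ↦ by
      rw [hasCardinalLT_iff_cardinal_mk_lt, Order.lt_succ_iff] at hX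
      refine ⟨Set.univ, ?_, fun x ↦ ⟨x, Set.mem_univ x, le_rfl⟩⟩
      rw [hasCardinalLT_iff_cardinal_mk_lt, Order.lt_succ_iff, mk_univ]
      refine le_trans (mk_le_of_injective
        (f := fun t ↦ (⟨t.1, ?_⟩ : {t : Set X // #t < μ})) ?_) (mk_setCardinalLT_le hμκ hκ X hX)
      · exact (hasCardinalLT_iff_cardinal_mk_lt _ _).1 t.2
      · intro t t' h
        exact Subtype.ext (congrArg (fun s ↦ s.1) h)) A
    (by rwa [hasCardinalLT_iff_cardinal_mk_lt, Order.lt_succ_iff])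
  rw [hasCardinalLT_iff_cardinal_mk_lt, Order.lt_succ_iff] at hB'
  exact ⟨B, hAB, hB, hB'⟩

end

/-! ### Colimits over subsets of the index poset. -/

namespace CategoryTheory

open Limits

section

variable {C : Type u} [Category.{v} C] {J : Type w} [PartialOrder J] (D : J ⥤ C)

/-- The restriction of a diagram indexed by a poset to a subset of the index poset. -/
abbrev restrictDiagram (S : Set J) : S ⥤ C :=
  (show Monotone (Subtype.val : S → J) from fun _ _ h ↦ h).functor ⋙ D

/-- The colimit of the restriction of a poset-indexed diagram to a subset of the index poset. -/
noncomputable def colimitOn (S : Set J) [HasColimit (restrictDiagram D S)] : C :=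
  colimit (restrictDiagram D S)

namespace colimitOn

variable (S : Set J) [HasColimit (restrictDiagram D S)]

/-- The structure morphisms of `colimitOn D S`. -/
noncomputable def ι {j : J} (h : j ∈ S) : D.obj j ⟶ colimitOn D S :=
  colimit.ι (restrictDiagram D S) ⟨j, h⟩

theorem w {j j' : J} (h : j ∈ S) (h' : j' ∈ S) (f : j ⟶ j') : D.map f ≫ ι D S h' = ι D S h :=
  colimit.w (restrictDiagram D S) (homOfLE (leOfHom f) : (⟨j, h⟩ : S) ⟶ ⟨j', h'⟩)

variable {D S}

theorem hom_ext {X : C} {f g : colimitOn D S ⟶ X}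
    (h : ∀ (j : J) (hj : j ∈ S), ι D S hj ≫ f = ι D S hj ≫ g) : f = g :=
  colimit.hom_ext fun s ↦ h s.1 s.2

/-- The morphism from `colimitOn D S` induced by a compatible family. -/
noncomputable def desc {X : C} (φ : ∀ j ∈ S, D.obj j ⟶ X)
    (hφ : ∀ (j j' : J) (h : j ∈ S) (h' : j' ∈ S) (f : j ⟶ j'), D.map f ≫ φ j' h' = φ j h) :
    colimitOn D S ⟶ X :=
  colimit.desc (restrictDiagram D S)
    ⟨X, { app := fun s ↦ φ s.1 s.2
          naturality := fun s t f ↦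
            (hφ s.1 t.1 s.2 t.2 (homOfLE (leOfHom f))).trans (Category.comp_id _).symm }⟩

theorem ι_desc {X : C} (φ : ∀ j ∈ S, D.obj j ⟶ X)
    (hφ : ∀ (j j' : J) (h : j ∈ S) (h' : j' ∈ S) (f : j ⟶ j'), D.map f ≫ φ j' h' = φ j h)
    {j : J} (h : j ∈ S) : ι D S h ≫ desc φ hφ = φ j h :=
  colimit.ι_desc _ _

/-- The morphism from `colimitOn D S` to the point of a cocone over the whole diagram. -/
noncomputable def toPt (c : Cocone D) : colimitOn D S ⟶ c.pt :=
  desc (fun j _ ↦ c.ι.app j) fun _ _ _ _ f ↦ c.w f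

theorem ι_toPt (c : Cocone D) {j : J} (h : j ∈ S) : ι D S h ≫ toPt c = c.ι.app j :=
  ι_desc _ _ h

theorem exists_factors {μ : Cardinal.{w}} [Fact μ.IsRegular] [IsCardinalFiltered S μ] {X : C}
    [IsCardinalPresentable X μ] (f : X ⟶ colimitOn D S) :
    ∃ (j : J) (h : j ∈ S) (g : X ⟶ D.obj j), g ≫ ι D S h = f := by
  have := essentiallySmall_of_small_of_locallySmall.{w} S
  obtain ⟨j, g, hg⟩ := IsCardinalPresentable.exists_hom_of_isColimit (X := X) μ
    (colimit.isColimit (restrictDiagram D S)) f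
  exact ⟨j.1, j.2, g, hg⟩

end colimitOn

variable {μ : Cardinal.{w}} [Fact μ.IsRegular] [HasCardinalFilteredColimits.{w} C μ]

theorem hasColimit_restrictDiagram (S : Set J) [IsCardinalFiltered S μ] :
    HasColimit (restrictDiagram D S) :=
  have := HasCardinalFilteredColimits.hasColimitsOfShape (κ := μ) C S
  inferInstance

variable {D} in
/-- Suppose `J` is covered by a `κ`-directed family of `μ`-directed subsets `S i`.
If the colimit of a diagram indexed by `J` is `κ`-presentable, then all morphisms to it from
`μ`-presentable objects factor through the terms of the diagram indexed by one of the `S i`. -/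
theorem exists_factors_through_of_isCardinalPresentable {c : Cocone D} (hc : IsColimit c)
    {κ : Cardinal.{w}} [Fact κ.IsRegular] [IsCardinalPresentable c.pt κ]
    {I : Type w} [PartialOrder I] [IsCardinalFiltered I κ] {S : I → Set J} (hS : Monotone S)
    (hfilt : ∀ i, IsCardinalFiltered (S i) μ) (hcover : ∀ j, ∃ i, j ∈ S i) :
    ∃ i, ∀ (X : C) [IsCardinalPresentable X μ] (f : X ⟶ c.pt),
      ∃ j ∈ S i, ∃ g : X ⟶ D.obj j, g ≫ c.ι.app j = f := by
  have hcol (i : I) := hasColimit_restrictDiagram (μ := μ) D (S i)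
  have : IsDirectedOrder I :=
    have := isFiltered_of_isCardinalFiltered I κ
    IsFiltered.isDirectedOrder I
  let incl {i j : I} (h : i ≤ j) : colimitOn D (S i) ⟶ colimitOn D (S j) :=
    colimitOn.desc (fun s hs ↦ colimitOn.ι D (S j) (hS h hs)) fun _ _ _ _ f ↦ colimitOn.w _ _ _ _ f
  have ι_incl {i j : I} (h : i ≤ j) {s : J} (hs : s ∈ S i) :
      colimitOn.ι D (S i) hs ≫ incl h = colimitOn.ι D (S j) (hS h hs) := colimitOn.ι_desc _ _ _
  let G : I ⥤ C :=
    { obj := fun i ↦ colimitOn D (S i)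
      map := fun f ↦ incl (leOfHom f)
      map_id := fun i ↦ colimitOn.hom_ext fun s hs ↦ by
        rw [ι_incl le_rfl, Category.comp_id]
      map_comp := fun f g ↦ colimitOn.hom_ext fun s hs ↦ by
        rw [ι_incl (leOfHom (f ≫ g)), ← Category.assoc, ι_incl (leOfHom f), ι_incl (leOfHom g)] }
  have ι_map {i j : I} (f : i ⟶ j) {s : J} (hs : s ∈ S i) :
      colimitOn.ι D (S i) hs ≫ G.map f = colimitOn.ι D (S j) (hS (leOfHom f) hs) :=
    ι_incl (leOfHom f) hs
  have m_naturality {i j : I} (f : i ⟶ j) : G.map f ≫ colimitOn.toPt c = colimitOn.toPt c :=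
    colimitOn.hom_ext fun s hs ↦ by
      rw [← Category.assoc, ι_map, colimitOn.ι_toPt, colimitOn.ι_toPt]
  let d : Cocone G := ⟨c.pt,
    { app := fun i ↦ colimitOn.toPt c
      naturality := fun i j f ↦ (m_naturality f).trans (Category.comp_id _).symm }⟩
  choose idx hidx using hcover
  -- A cocone over the stages gives one over `D`: directedness of `I` makes the component at `j`
  -- independent of the stage containing `j`.
  let φ (t : Cocone G) (j : J) : D.obj j ⟶ t.pt :=
    colimitOn.ι D (S (idx j)) (hidx j) ≫ t.ι.app (idx j)
  have hφ (t : Cocone G) (j : J) (i : I) (h : j ∈ S i) :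
      colimitOn.ι D (S i) h ≫ t.ι.app i = φ t j := by
    obtain ⟨k, hik, hjk⟩ := exists_ge_ge i (idx j)
    dsimp only [φ]
    rw [← t.w (homOfLE hik), ← t.w (homOfLE hjk), ← Category.assoc, ← Category.assoc, ι_map, ι_map]
  have φ_naturality (t : Cocone G) {j j' : J} (f : j ⟶ j') : D.map f ≫ φ t j' = φ t j := by
    obtain ⟨k, hjk, hjk'⟩ := exists_ge_ge (idx j) (idx j')
    rw [← hφ t j k (hS hjk (hidx j)), ← hφ t j' k (hS hjk' (hidx j')), ← Category.assoc,
      colimitOn.w]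
  let e (t : Cocone G) : Cocone D := ⟨t.pt,
    { app := φ t, naturality := fun j j' f ↦ (φ_naturality t f).trans (Category.comp_id _).symm }⟩
  let hd : IsColimit d :=
    { desc := fun t ↦ hc.desc (e t)
      fac := fun t i ↦ colimitOn.hom_ext fun s hs ↦ by
        rw [← Category.assoc]
        refine (congrArg (· ≫ hc.desc (e t)) (colimitOn.ι_toPt c hs)).trans ?_
        exact (hc.fac (e t) s).trans (hφ t s i hs).symm
      uniq := fun t f hf ↦ hc.hom_ext fun j ↦ by
        rw [hc.fac, ← colimitOn.ι_toPt c (hidx j), Category.assoc]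
        exact congrArg _ (hf (idx j)) }
  have := essentiallySmall_of_small_of_locallySmall.{w} I
  -- Factoring the identity gives a section `s` of the map from stage `i`; composing with `s`
  -- reduces the claim to `μ`-presentability at that stage.
  obtain ⟨i, s, hs⟩ := IsCardinalPresentable.exists_hom_of_isColimit (X := c.pt) κ hd (𝟙 _)
  refine ⟨i, fun X _ f ↦ ?_⟩
  obtain ⟨j, hj, g, hg⟩ := colimitOn.exists_factors (μ := μ) (X := X) (f ≫ s)
  refine ⟨j, hj, g, ?_⟩
  rw [← colimitOn.ι_toPt c hj, ← Category.assoc, hg, Category.assoc]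
  exact (congrArg (f ≫ ·) hs).trans (Category.comp_id f)

variable {D} in
/-- If all morphisms are monomorphisms and all terms of a colimit diagram map to the colimit
through terms indexed by a subset `S`, then the colimit over `S` is the whole colimit. -/
theorem nonempty_iso_colimitOn (hmono : ∀ {X Y : C} (f : X ⟶ Y), Mono f)
    {c : Cocone D} (hc : IsColimit c) (S : Set J) [HasColimit (restrictDiagram D S)]
    (h : ∀ j, ∃ s ∈ S, ∃ g : D.obj j ⟶ D.obj s, g ≫ c.ι.app s = c.ι.app j) :
    Nonempty (colimitOn D S ≅ c.pt) := by
  let m : colimitOn D S ⟶ c.pt := colimitOn.toPt c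
  -- Monicity of `m` makes the chosen factorizations compatible and turns the resulting section of
  -- `m` into an inverse.
  have := hmono m
  choose s hs g hg using h
  let φ (j : J) : D.obj j ⟶ colimitOn D S := g j ≫ colimitOn.ι D S (hs j)
  have φ_m (j : J) : φ j ≫ m = c.ι.app j := by
    dsimp only [φ, m]
    rw [Category.assoc, colimitOn.ι_toPt, hg]
  have φ_naturality {j j' : J} (f : j ⟶ j') : D.map f ≫ φ j' = φ j := by
    rw [← cancel_mono m, Category.assoc, φ_m, φ_m, c.w]
  let e : Cocone D := ⟨colimitOn D S,
    { app := φ, naturality := fun j j' f ↦ (φ_naturality f).trans (Category.comp_id _).symm }⟩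
  let r : c.pt ⟶ colimitOn D S := hc.desc e
  have hφr (j : J) : c.ι.app j ≫ r = φ j := hc.fac e j
  have hr : r ≫ m = 𝟙 _ := hc.hom_ext fun j ↦ by
    rw [← Category.assoc, hφr, φ_m, Category.comp_id]
  exact ⟨⟨m, r, by rw [← cancel_mono m, Category.assoc, hr, Category.comp_id, Category.id_comp],
    hr⟩⟩

end

theorem hasCardinalLT_arrow_of_mk_le {J : Type w} [Preorder J] {κ : Cardinal.{w}} (hκ : ℵ₀ ≤ κ)
    (hJ : #J ≤ κ) : HasCardinalLT (Arrow J) (Order.succ κ) := by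
  refine HasCardinalLT.of_injective (X := J × J) ?_ (fun f ↦ (f.left, f.right)) ?_
  · rw [hasCardinalLT_iff_cardinal_mk_lt, Order.lt_succ_iff]
    simpa using mul_le_of_le hκ hJ hJ
  · rintro ⟨X, Y, f⟩ ⟨X', Y', f'⟩ h
    obtain ⟨h₁, h₂⟩ : X = X' ∧ Y = Y' := by simpa using h
    subst h₁ h₂
    obtain rfl : f = f' := Subsingleton.elim (α := X ⟶ Y) f f'
    rfl

theorem isCardinalPresentable_colimitOn {C : Type u} [Category.{w} C] {J : Type w}
    [PartialOrder J] {D : J ⥤ C} {μ κ : Cardinal.{w}} [Fact μ.IsRegular]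
    [Fact (Order.succ κ).IsRegular] (hμκ : μ ≤ κ) (S : Set J) [HasColimit (restrictDiagram D S)]
    (hS : #S ≤ κ) (hD : ∀ j ∈ S, IsCardinalPresentable (D.obj j) μ) :
    IsCardinalPresentable (colimitOn D S) (Order.succ κ) :=
  have (b : S) : IsCardinalPresentable ((restrictDiagram D S).obj b) (Order.succ κ) :=
    have : IsCardinalPresentable ((restrictDiagram D S).obj b) μ := hD b.1 b.2
    isCardinalPresentable_of_le (κ := μ) _ (hμκ.trans (Order.le_succ κ))
  isCardinalPresentable_of_isColimit.{w} _ (colimit.isColimit (restrictDiagram D S)) _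
    (hasCardinalLT_arrow_of_mk_le ((IsRegular.aleph0_le Fact.out : ℵ₀ ≤ μ).trans hμκ) hS)

section

variable {C : Type u} [Category.{w} C] {J : Type w} [PartialOrder J] {D : J ⥤ C}
  {μ : Cardinal.{w}} [Fact μ.IsRegular] [HasCardinalFilteredColimits.{w} C μ]

/-- If a `κ⁺`-presentable object is the colimit of a `μ`-directed diagram, where
`κ ^{<μ} = κ`, then all morphisms to it from `μ`-presentable objects factor through the terms
indexed by some `μ`-directed subset of cardinality at most `κ`. -/
theorem exists_small_factors_through_of_isCardinalPresentable_succ {κ : Cardinal.{w}}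
    (hμκ : μ ≤ κ) (hκ : ∀ ν < μ, κ ^ ν ≤ κ) [IsCardinalFiltered J μ]
    {c : Cocone D} (hc : IsColimit c) [Fact (Order.succ κ).IsRegular]
    [IsCardinalPresentable c.pt (Order.succ κ)] :
    ∃ S : Set J, IsCardinalFiltered S μ ∧ #S ≤ κ ∧
      ∀ (X : C) [IsCardinalPresentable X μ] (f : X ⟶ c.pt),
        ∃ j ∈ S, ∃ g : X ⟶ D.obj j, g ≫ c.ι.app j = f := by
  have hκ₀ : ℵ₀ ≤ κ := (IsRegular.aleph0_le Fact.out : ℵ₀ ≤ μ).trans hμκ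
  have : IsCardinalFiltered {S : Set J // IsCardinalFiltered S μ ∧ #S ≤ κ} (Order.succ κ) :=
    isCardinalFiltered_preorder _ _ fun A f hA ↦ by
      obtain ⟨B, hB, hB', hB''⟩ := exists_isCardinalFiltered_superset hμκ hκ (⋃ a, (f a).1) (by
        refine (mk_iUnion_le_sum_mk).trans ((sum_le_sum _ _ fun a ↦ (f a).2.2).trans ?_)
        simpa using mul_le_of_le hκ₀ (Order.lt_succ_iff.1 hA) le_rfl)
      exact ⟨⟨B, hB', hB''⟩, fun a ↦ (Set.subset_iUnion (fun a ↦ (f a).1) a).trans hB⟩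
  obtain ⟨S, hS⟩ := exists_factors_through_of_isCardinalPresentable (μ := μ) hc
    (κ := Order.succ κ) (I := {S : Set J // IsCardinalFiltered S μ ∧ #S ≤ κ})
    (S := fun S ↦ S.1) (fun _ _ h ↦ h) (fun S ↦ S.2.1) (fun j ↦ by
      obtain ⟨B, hB, hB', hB''⟩ := exists_isCardinalFiltered_superset hμκ hκ {j}
        (by simpa using one_le_aleph0.trans hκ₀)
      exact ⟨⟨B, hB', hB''⟩, hB rfl⟩)
  exact ⟨S.1, S.2.1, S.2.2, hS⟩

/-- If the colimit of a `μ`-directed diagram of `μ`-presentable objects is not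
`κ⁺`-presentable, where `κ ^{<μ} = κ`, then for any set `A` of at most `κ` indices, some term of
the diagram does not map to the colimit through a term indexed by `A`. -/
theorem exists_not_factors_through {κ : Cardinal.{w}} (hμκ : μ ≤ κ)
    (hκ : ∀ ν < μ, κ ^ ν ≤ κ) (hmono : ∀ {X Y : C} (f : X ⟶ Y), Mono f)
    [IsCardinalFiltered J μ] (hD : ∀ j, IsCardinalPresentable (D.obj j) μ)
    {c : Cocone D} (hc : IsColimit c) [Fact (Order.succ κ).IsRegular]
    (hpres : ¬ IsCardinalPresentable c.pt (Order.succ κ)) (A : Set J) (hA : #A ≤ κ) :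
    ∃ x, ∀ a ∈ A, ∀ g : D.obj x ⟶ D.obj a, g ≫ c.ι.app a ≠ c.ι.app x := by
  by_contra! h
  obtain ⟨B, hAB, hB, hB'⟩ := exists_isCardinalFiltered_superset hμκ hκ A hA
  have := hasColimit_restrictDiagram (μ := μ) D B
  obtain ⟨e⟩ := nonempty_iso_colimitOn hmono hc B fun j ↦ by
    obtain ⟨a, ha, g, hg⟩ := h j
    exact ⟨a, hAB ha, g, hg⟩
  have := isCardinalPresentable_colimitOn hμκ B hB' fun j _ ↦ hD j
  exact hpres (isCardinalPresentable_of_iso e _)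

end

end CategoryTheory

/-! ### Transfinite chains of directed subsets. -/

/-- If no set of at most `lam` indices dominates a `μ`-directed poset `J` with respect to a
relation `R`, where `lam ^{<μ} = lam`, then there is a chain of length `lam` of `μ`-directed
subsets of `J` of cardinality at most `lam`, each of which has an element that is not dominated
by the previous ones. -/
theorem exists_chain_of_forall_exists_not_rel {J : Type w} [PartialOrder J]
    {μ lam : Cardinal.{w}} [Fact μ.IsRegular] [IsCardinalFiltered J μ] (hμ : μ ≤ lam)
    (hlam : ∀ ν < μ, lam ^ ν ≤ lam) (R : J → J → Prop)
    (hR : ∀ A : Set J, #A ≤ lam → ∃ x, ∀ a ∈ A, ¬ R x a) :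
    ∃ (S : lam.ord.ToType → Set J) (x : lam.ord.ToType → J), Monotone S ∧
      (∀ i, IsCardinalFiltered (S i) μ) ∧ (∀ i, #(S i) ≤ lam) ∧ (∀ i, x i ∈ S i) ∧
      ∀ i j, j < i → ∀ a ∈ S j, ¬ R (x i) a := by
  have hlam₀ : ℵ₀ ≤ lam := (IsRegular.aleph0_le Fact.out : ℵ₀ ≤ μ).trans hμ
  obtain ⟨x₀, -⟩ := hR ∅ (by simp)
  -- For oversized `A` the values are junk; the size bound `hU` ensures that the recursion never
  -- meets them.
  have step (A : Set J) : ∃ (B : Set J) (x : J), #A ≤ lam →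
      A ⊆ B ∧ IsCardinalFiltered B μ ∧ #B ≤ lam ∧ x ∈ B ∧ ∀ a ∈ A, ¬ R x a := by
    by_cases hA : #A ≤ lam
    · obtain ⟨x, hx⟩ := hR A hA
      obtain ⟨B, hB, hB', hB''⟩ := exists_isCardinalFiltered_superset hμ hlam (insert x A)
        (mk_insert_le.trans (add_le_of_le hlam₀ hA (one_le_aleph0.trans hlam₀)))
      exact ⟨B, x, fun _ ↦ ⟨(Set.subset_insert x A).trans hB, hB', hB'',
        hB (Set.mem_insert x A), hx⟩⟩
    · exact ⟨A, x₀, fun h ↦ (hA h).elim⟩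
  choose F X hF using step
  let S : lam.ord.ToType → Set J :=
    wellFounded_lt.fix fun i ih ↦ F (⋃ j : Set.Iio i, ih j.1 j.2)
  let U (i : lam.ord.ToType) : Set J := ⋃ j : Set.Iio i, S j.1
  have hSU (i : lam.ord.ToType) : S i = F (U i) := wellFounded_lt.fix_eq _ i
  have hU (i : lam.ord.ToType) : #(U i) ≤ lam := by
    induction i using WellFoundedLT.induction with
    | ind i ih =>
      refine mk_iUnion_le_sum_mk.trans ((sum_le_sum _ (fun _ ↦ lam) fun j ↦ ?_).trans ?_)
      · rw [hSU]
        exact (hF _ (ih j.1 j.2)).2.2.1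
      · simpa using mul_le_of_le hlam₀ (mk_Iio_lt_of_toType_ord i).le le_rfl
  have hsub {i j : lam.ord.ToType} (h : j < i) : S j ⊆ U i :=
    Set.subset_iUnion (fun j : Set.Iio i ↦ S j.1) ⟨j, h⟩
  refine ⟨S, fun i ↦ X (U i), fun i j hij ↦ ?_, fun i ↦ ?_, fun i ↦ ?_, fun i ↦ ?_,
    fun i j hij a ha ↦ (hF _ (hU i)).2.2.2.2 a (hsub hij ha)⟩
  · rcases hij.eq_or_lt with rfl | h
    · exact le_rfl
    · exact (hsub h).trans ((hSU j).symm ▸ (hF _ (hU j)).1)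
  · exact (hSU i).symm ▸ (hF _ (hU i)).2.1
  · exact (hSU i).symm ▸ (hF _ (hU i)).2.2.1
  · exact (hSU i).symm ▸ (hF _ (hU i)).2.2.2.1

/-- The union of a chain of `μ`-directed subsets of length of cofinality at least `μ`
is `μ`-directed. -/
theorem isCardinalFiltered_iUnion_of_monotone {J : Type w} [PartialOrder J]
    {μ lam : Cardinal.{w}} [Fact μ.IsRegular] (hcof : μ ≤ lam.ord.cof)
    {S : lam.ord.ToType → Set J} (hS : Monotone S) (hfilt : ∀ i, IsCardinalFiltered (S i) μ) :
    IsCardinalFiltered (⋃ i, S i) μ :=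
  isCardinalFiltered_coe_set fun A f hA hf ↦ by
    choose idx hidx using fun a ↦ Set.mem_iUnion.1 (hf a)
    obtain ⟨i, hi⟩ := exists_forall_lt_of_mk_lt_cof (hA.trans_le hcof) idx
    obtain ⟨j, hj, hle⟩ :=
      exists_mem_upperBound_of_isCardinalFiltered (S := S i) f hA fun a ↦ hS (hi a).le (hidx a)
    exact ⟨j, Set.mem_iUnion.2 ⟨i, hj⟩, hle⟩

theorem isCardinalFiltered_setOf_val_mem {J : Type w} [PartialOrder J] {μ : Cardinal.{w}}
    [Fact μ.IsRegular] {S T : Set J} [IsCardinalFiltered S μ] (h : S ⊆ T) :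
    IsCardinalFiltered {t : T | t.1 ∈ S} μ :=
  isCardinalFiltered_coe_set fun A f hA hf ↦ by
    obtain ⟨j, hj, hle⟩ :=
      exists_mem_upperBound_of_isCardinalFiltered (S := S) (fun a ↦ (f a).1) hA hf
    exact ⟨⟨j, h hj⟩, hj, hle⟩

/-! ### Objects of prescribed presentability. -/

namespace CategoryTheory

open Limits

variable {C : Type u} [Category.{w} C] {μ : Cardinal.{w}} [Fact μ.IsRegular]

theorem ObjectProperty.IsCardinalFilteredGenerator.exists_directed {P : ObjectProperty C}
    (hP : P.IsCardinalFilteredGenerator μ) (X : C) :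
    ∃ (J : Type w) (_ : PartialOrder J) (_ : IsCardinalFiltered J μ),
      Nonempty (P.ColimitOfShape J X) := by
  obtain ⟨J, _, _, ⟨p⟩⟩ := hP.exists_colimitsOfShape X
  obtain ⟨α, _, _, F, _⟩ := IsCardinalFiltered.exists_cardinal_directed J μ
  exact ⟨α, inferInstance, inferInstance, ⟨p.reindex F⟩⟩

/-- If all morphisms are monomorphisms, `lam ^{<μ} = lam` and all objects are
`lam⁺`-presentable, then the category is essentially small. -/
theorem essentiallySmall_of_forall_isCardinalPresentable
    (hmono : ∀ {X Y : C} (f : X ⟶ Y), Mono f) [HasCardinalFilteredColimits.{w} C μ]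
    {P : ObjectProperty C} [ObjectProperty.EssentiallySmall.{w} P]
    (hP : P.IsCardinalFilteredGenerator μ) {lam : Cardinal.{w}} (hμ : μ ≤ lam)
    (hlam : ∀ ν < μ, lam ^ ν ≤ lam) [Fact (Order.succ lam).IsRegular]
    (h : ∀ X : C, IsCardinalPresentable X (Order.succ lam)) : EssentiallySmall.{w} C := by
  have hlam₀ : ℵ₀ ≤ lam := (IsRegular.aleph0_le Fact.out : ℵ₀ ≤ μ).trans hμ
  -- Each `X` is a colimit of at most `lam` generators, and the closure of `P` under such colimits
  -- is essentially small.
  have hall (X : C) : P.colimitsCardinalClosure (Order.succ lam) X := by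
    obtain ⟨J, _, _, ⟨p⟩⟩ := hP.exists_directed X
    have : IsCardinalPresentable p.cocone.pt (Order.succ lam) := h X
    obtain ⟨S, hS, hS', hfac⟩ :=
      exists_small_factors_through_of_isCardinalPresentable_succ hμ hlam p.isColimit
    have := hasColimit_restrictDiagram (μ := μ) p.diag S
    obtain ⟨e⟩ := nonempty_iso_colimitOn hmono p.isColimit S fun j ↦
      have : IsCardinalPresentable (p.diag.obj j) μ :=
        hP.le_isCardinalPresentable _ (p.prop_diag_obj j)
      hfac (p.diag.obj j) (p.ι.app j)
    refine (P.colimitsCardinalClosure (Order.succ lam)).prop_of_iso e ?_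
    have := P.isClosedUnderColimitsOfShape_colimitsCardinalClosure (Order.succ lam) S
      (hasCardinalLT_arrow_of_mk_le hlam₀ hS')
    exact (P.colimitsCardinalClosure (Order.succ lam)).prop_colimit (restrictDiagram p.diag S)
      fun s ↦ P.le_colimitsCardinalClosure _ _ (p.prop_diag_obj s.1)
  exact essentiallySmall_iff_objectPropertyEssentiallySmall.2 ⟨inferInstance,
    .of_le (Q := P.colimitsCardinalClosure (Order.succ lam)) fun X _ ↦ hall X⟩

/-- The set of morphisms from (representatives of) objects in a small class `P` to `X`. -/
abbrev HomsFrom (P : ObjectProperty C) [ObjectProperty.Small.{w} P] (X : C) : Type w :=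
  Σ p : Shrink.{w} (Subtype P), ((equivShrink (Subtype P)).symm p).1 ⟶ X

/-- If all morphisms are monomorphisms, `lam ^{<μ} = lam`, `μ ≤ cf lam` and some object is not
`lam⁺`-presentable, then there is a `lam⁺`-presentable object which is not `lam`-presentable (if
`lam` is regular) and not `κ⁺`-presentable for all large enough `κ = κ ^{<μ} < lam`. -/
theorem exists_isCardinalPresentable_succ_of_not (hmono : ∀ {X Y : C} (f : X ⟶ Y), Mono f)
    [HasCardinalFilteredColimits.{w} C μ] {P : ObjectProperty C} [ObjectProperty.Small.{w} P]
    (hP : P.IsCardinalFilteredGenerator μ) {lam : Cardinal.{w}} (hμ : μ ≤ lam)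
    (hlam : ∀ ν < μ, lam ^ ν ≤ lam) (hcof : μ ≤ lam.ord.cof) [Fact (Order.succ lam).IsRegular]
    {N : C} (hN : ¬ IsCardinalPresentable N (Order.succ lam)) :
    ∃ M : C, IsCardinalPresentable M (Order.succ lam) ∧
      (∀ [Fact lam.IsRegular], ¬ IsCardinalPresentable M lam) ∧
      ∀ κ < lam, μ ≤ κ → (∀ ν < μ, κ ^ ν ≤ κ) → (∀ q, P q → #(HomsFrom P q) ≤ κ) →
        ∀ [Fact (Order.succ κ).IsRegular], ¬ IsCardinalPresentable M (Order.succ κ) := by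
  have hlam₀ : ℵ₀ ≤ lam := (IsRegular.aleph0_le Fact.out : ℵ₀ ≤ μ).trans hμ
  obtain ⟨J, _, _, ⟨p⟩⟩ := hP.exists_directed N
  let D : J ⥤ C := p.diag
  let c : Cocone D := p.cocone
  have hD (j : J) : IsCardinalPresentable (D.obj j) μ :=
    hP.le_isCardinalPresentable _ (p.prop_diag_obj j)
  obtain ⟨S, x, hS, hfilt, hcard, hx, hR⟩ := exists_chain_of_forall_exists_not_rel hμ hlam
    (fun x a ↦ ∃ g : D.obj x ⟶ D.obj a, g ≫ c.ι.app a = c.ι.app x) (fun A hA ↦ by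
      obtain ⟨x, hx⟩ := exists_not_factors_through hμ hlam hmono hD p.isColimit hN A hA
      exact ⟨x, fun a ha ⟨g, hg⟩ ↦ hx a ha g hg⟩)
  have hT := isCardinalFiltered_iUnion_of_monotone hcof hS hfilt
  have hTcard : #(⋃ i, S i) ≤ lam := by
    refine mk_iUnion_le_sum_mk.trans ((sum_le_sum _ (fun _ ↦ lam) hcard).trans ?_)
    simpa using mul_le_of_le hlam₀ le_rfl le_rfl
  generalize hTdef : (⋃ i, S i) = T at hT hTcard
  have hST (i) : S i ⊆ T := hTdef ▸ Set.subset_iUnion S i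
  have := hasColimit_restrictDiagram (μ := μ) D T
  -- Factorizations over the new colimit persist over `N`, where the chain forbids them.
  have hfac {i : lam.ord.ToType} {j : J} (hj : j ∈ T) (g : D.obj (x i) ⟶ D.obj j)
      (hg : g ≫ colimitOn.ι D T hj = colimitOn.ι D T (hST i (hx i))) :
      g ≫ c.ι.app j = c.ι.app (x i) := by
    rw [← colimitOn.ι_toPt (S := T) c hj, ← Category.assoc, hg, colimitOn.ι_toPt]
  refine ⟨colimitOn D T, isCardinalPresentable_colimitOn hμ T hTcard fun j _ ↦ hD j, ?_, ?_⟩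
  · intro hreg hpres
    have : IsCardinalPresentable (colimit.cocone (restrictDiagram D T)).pt lam := hpres
    obtain ⟨i, hi⟩ := exists_factors_through_of_isCardinalPresentable (μ := μ) (κ := lam)
      (colimit.isColimit (restrictDiagram D T)) (I := lam.ord.ToType)
      (S := fun i ↦ {t : T | t.1 ∈ S i}) (fun i j h t ht ↦ hS h ht)
      (fun i ↦ isCardinalFiltered_setOf_val_mem (hST i))
      (fun j ↦ (Set.mem_iUnion (s := S)).1 (hTdef.ge j.2))
    have : NoMaxOrder lam.ord.ToType := Cardinal.noMaxOrder hlam₀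
    obtain ⟨i', hi'⟩ := exists_gt i
    obtain ⟨j, hj, g, hg⟩ := hi (D.obj (x i')) (colimitOn.ι D T (hST i' (hx i')))
    exact hR i' i hi' j.1 hj ⟨g, hfac j.2 g hg⟩
  · intro κ hκlam hμκ hκ hPκ _ hpres
    have hκ₀ : ℵ₀ ≤ κ := (IsRegular.aleph0_le Fact.out : ℵ₀ ≤ μ).trans hμκ
    have : IsCardinalPresentable (colimit.cocone (restrictDiagram D T)).pt (Order.succ κ) := hpres
    obtain ⟨B, -, hB, hi⟩ := exists_small_factors_through_of_isCardinalPresentable_succ hμκ hκ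
      (colimit.isColimit (restrictDiagram D T))
    have hi' (i : lam.ord.ToType) : ∃ b : B, ∃ g : D.obj (x i) ⟶ D.obj b.1.1,
        g ≫ c.ι.app b.1.1 = c.ι.app (x i) := by
      obtain ⟨j, hj, g, hg⟩ := hi (D.obj (x i)) (colimitOn.ι D T (hST i (hx i)))
      exact ⟨⟨j, hj⟩, g, hfac j.2 g hg⟩
    choose b g hg using hi'
    -- Objects over `N` allow maps with different domains to be compared. At most `κ` of them arise
    -- from a term in `B` and a map to it from a generator.
    let toOver (e : Σ b : B, HomsFrom P (D.obj b.1.1)) : Over c.pt :=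
      Over.mk (e.2.2 ≫ c.ι.app e.1.1.1)
    have key (i : lam.ord.ToType) : ∃ e : Σ b : B, HomsFrom P (D.obj b.1.1),
        toOver e = Over.mk (c.ι.app (x i)) := by
      have (p' : Subtype P) (h : p' = ⟨D.obj (x i), p.prop_diag_obj (x i)⟩) :
          ∃ g' : p'.1 ⟶ D.obj (b i).1.1,
            Over.mk (g' ≫ c.ι.app (b i).1.1) = Over.mk (c.ι.app (x i)) := by
        subst h
        exact ⟨g i, by rw [hg]⟩
      obtain ⟨g', hg'⟩ := this _ ((equivShrink (Subtype P)).symm_apply_apply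
        ⟨D.obj (x i), p.prop_diag_obj (x i)⟩)
      exact ⟨⟨b i, _, g'⟩, hg'⟩
    choose e he using key
    -- Equal objects over `N` would make `x i` factor through the earlier `x j`.
    have hne {i j : lam.ord.ToType} (h : j < i) : e i ≠ e j := fun h' ↦ by
      have heq : Over.mk (c.ι.app (x i)) = Over.mk (c.ι.app (x j)) := by
        rw [← he, ← he, h']
      exact hR i j h (x j) (hx j) ⟨(eqToHom heq).left, Over.w (eqToHom heq)⟩
    have hinj : Function.Injective e := fun i j h ↦ by
      rcases lt_trichotomy i j with h' | h' | h'
      · exact (hne h' h.symm).elim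
      · exact h'
      · exact (hne h' h).elim
    have hle := mk_le_of_injective hinj
    rw [mk_sigma] at hle
    have := hle.trans (sum_le_sum _ (fun _ ↦ κ) fun b ↦ hPκ _ (p.prop_diag_obj b.1.1))
    have hBκ : #B * κ ≤ κ := mul_le_of_le hκ₀ hB le_rfl
    exact (this.trans (by simpa using hBκ)).not_gt (by simpa using hκlam)

end CategoryTheory

/-! ### Computing the rank. -/

theorem presentabilityRank_eq {C : Type u} [Category.{v} C] {M : C} {κ : Cardinal.{w}}
    [hκ : Fact κ.IsRegular] (h : IsCardinalPresentable M κ)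
    (hlt : ∀ κ' < κ, ∀ [Fact κ'.IsRegular], ¬ IsCardinalPresentable M κ') :
    presentabilityRank.{w} M = κ :=
  IsLeast.csInf_eq ⟨⟨hκ, h⟩, fun κ' ⟨_, h'⟩ ↦ not_lt.1 fun hκ' ↦ hlt κ' hκ' h'⟩

theorem mainTheorem11 {K : Type u} [Category.{w} K]
    (μ : Cardinal.{w}) [Fact μ.IsRegular]
    [IsCardinalAccessibleCategory.{w} K μ]
    (hlarge : ¬ EssentiallySmall.{w} K)
    (hmono : ∀ {X Y : K} (f : X ⟶ Y), Mono f)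
    (hset : GCH.{w} ∨ ∃ θ : Cardinal.{w}, SCHAbove μ θ) :
    ∃ χ : Cardinal.{w}, ∀ lam : Cardinal.{w}, χ ≤ lam → μ ≤ lam.ord.cof →
      ∃ M : K, internalSize.{w} M = lam := by
  have hμ₀ : ℵ₀ ≤ μ := IsRegular.aleph0_le Fact.out
  obtain ⟨θ, hθ⟩ : ∃ θ : Cardinal.{w}, SCHAbove μ θ :=
    hset.elim (fun h ↦ ⟨μ, h.schAbove hμ₀⟩) id
  obtain ⟨P, _, hP⟩ := HasCardinalFilteredGenerator.exists_small_generator K μ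
  let ν : Cardinal.{w} := #(Σ q : Shrink.{w} (Subtype P), HomsFrom P ((equivShrink _).symm q).1)
  have hν (q : K) (hq : P q) : #(HomsFrom P q) ≤ ν := by
    have := mk_le_of_injective (sigma_mk_injective (β := fun q : Shrink.{w} (Subtype P) ↦
      HomsFrom P ((equivShrink _).symm q).1) (i := equivShrink _ ⟨q, hq⟩))
    rwa [Equiv.symm_apply_apply] at this
  let χ := max (max μ θ) ν
  have hpow {κ : Cardinal.{w}} (hκ : χ ≤ κ) (hcof : μ ≤ κ.ord.cof) : ∀ ν < μ, κ ^ ν ≤ κ :=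
    have hμκ : μ ≤ κ := (le_max_left _ _).trans ((le_max_left _ _).trans hκ)
    fun _ h ↦ (hθ κ hμκ ((le_max_right _ _).trans ((le_max_left _ _).trans hκ))).power_le
      (hμ₀.trans hμκ) hcof h
  have hμχ : μ ≤ χ := (le_max_left _ _).trans (le_max_left _ _)
  -- The successor makes `χ < lam` strict, so that `max κ χ < lam` in the singular case.
  refine ⟨Order.succ χ, fun lam hlam hcof ↦ ?_⟩
  have hχlam : χ < lam := Order.succ_le_iff.1 hlam
  have hμlam : μ ≤ lam := hμχ.trans hχlam.le
  have hlam₀ : ℵ₀ ≤ lam := hμ₀.trans hμlam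
  have : Fact (Order.succ lam).IsRegular := ⟨isRegular_succ hlam₀⟩
  obtain ⟨N, hN⟩ : ∃ N : K, ¬ IsCardinalPresentable N (Order.succ lam) := by
    by_contra! h
    exact hlarge (essentiallySmall_of_forall_isCardinalPresentable hmono hP hμlam
      (hpow hχlam.le hcof) h)
  obtain ⟨M, hM, hreg, hsing⟩ := exists_isCardinalPresentable_succ_of_not hmono hP hμlam
    (hpow hχlam.le hcof) hcof hN
  refine ⟨M, internalSize_eq_of_rank_eq_succ M lam (presentabilityRank_eq hM ?_)⟩
  intro κ hκ hκreg hMκ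
  rw [Order.lt_succ_iff] at hκ
  by_cases hlamreg : lam.IsRegular
  · have : Fact lam.IsRegular := ⟨hlamreg⟩
    exact hreg (isCardinalPresentable_of_le M hκ)
  · have hκlam : κ < lam := hκ.lt_of_ne fun h ↦ hlamreg (h ▸ hκreg.out)
    -- Replace `κ` by `(max κ χ)⁺`: being regular, it has cofinality at least `μ`, so `hpow`
    -- applies, and it differs from the singular `lam`, so it stays below.
    have hmax₀ : ℵ₀ ≤ max κ χ := (hμ₀.trans hμχ).trans (le_max_right _ _)
    have hsucc : (Order.succ (max κ χ)).IsRegular := isRegular_succ hmax₀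
    have hκ'lam : Order.succ (max κ χ) < lam :=
      (Order.succ_le_of_lt (max_lt hκlam hχlam)).lt_of_ne fun h ↦ hlamreg (h ▸ hsucc)
    have hχκ' : χ ≤ Order.succ (max κ χ) := (le_max_right _ _).trans (Order.le_succ _)
    have : Fact (Order.succ (Order.succ (max κ χ))).IsRegular :=
      ⟨isRegular_succ hsucc.aleph0_le⟩
    refine hsing _ hκ'lam (hμχ.trans hχκ')
      (hpow hχκ' (by rw [hsucc.cof_ord]; exact hμχ.trans hχκ'))
      (fun q hq ↦ (hν q hq).trans ((le_max_right _ _).trans hχκ'))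
      (isCardinalPresentable_of_le M (κ := κ) ?_)
    exact (le_max_left _ _).trans ((Order.le_succ _).trans (Order.le_succ _))
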